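/- Let $(M,\varphi,\xi,\eta,g)$ be an almost contact metric manifold: $M$ is a smooth $(2n+1)$-dimensional manifold with a smooth Riemannian metric $g$, a smooth $(1,1)$-tensor field $\varphi$, a smooth vector field $\xi$ and a smooth $1$-form $\eta$ such that $\varphi^2=-I+\eta\otimes\xi$, $\eta(\xi)=1$ and $g(\varphi X,\varphi Y)=g(X,Y)-\eta(X)\eta(Y)$. Let $\nabla$ be the Levi-Civita connection of $g$, $R_{XY}Z=\nabla_X\nabla_YZ-\nabla_Y\nabla_XZ-\nabla_{[X,Y]}Z$ and $R(X,Y,Z,W)=-g(R_{XY}Z,W)$. Say that $M$ satisfies (G1), (G2), (G3), respectively, if for all smooth vector fields $X,Y,Z,W$ on $M$ (G1) $\;R(X,Y,\varphi Z,\varphi W)-R(X,Y,Z,W)=g(Y,\varphi W)g(X,\varphi Z)-g(X,\varphi W)g(Y,\varphi Z)+g(X,W)g(Y,Z)-g(Y,W)g(X,Z)$, (G2) $\;R(X,Y,Z,W)=R(\varphi X,Y,Z,\varphi W)+R(X,\varphi Y,Z,\varphi W)+R(X,Y,\varphi Z,\varphi W)+g(X,Z)\eta(W)\eta(Y)-g(Z,Y)\eta(X)\eta(W)$,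 (G3) $\;R(X,Y,Z,W)=R(\varphi X,\varphi Y,\varphi Z,\varphi W)+g(X,Z)\eta(W)\eta(Y)-g(Z,Y)\eta(X)\eta(W)+g(Y,W)\eta(X)\eta(Z)-g(X,W)\eta(Y)\eta(Z)$. For a class $\mathcal L$ of almost contact metric manifolds, let $\mathcal L_i$ be the subclass of those manifolds in $\mathcal L$ that satisfy (G$i$), $i=1,2,3$. Then $$\mathcal L_1\subseteq\mathcal L_2\subseteq\mathcal L_3\subseteq\mathcal L .$$ In particular every almost contact metric manifold satisfying (G1) satisfies (G2), and every one satisfying (G2) satisfies (G3). -/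

import Mathlib

open Bundle VectorField
open scoped Manifold ContDiff

universe u

noncomputable section

/-! ### Levi-Civita connection and curvature of a Riemannian manifold -/

section LeviCivita

variable {E : Type*} [NormedAddCommGroup E] [NormedSpace ℝ E]
  {H : Type*} [TopologicalSpace H] (I : ModelWithCorners ℝ E H)
  {M : Type*} [TopologicalSpace M] [ChartedSpace H M]

/-- `X f`: the derivative of the function `f` along the vector field `X`. -/
def derivAlong (X : Π x : M, TangentSpace I x) (f : M → ℝ) (x : M) : ℝ :=
  mvfderiv I f x (X x)

variable [RiemannianBundle (fun x : M ↦ TangentSpace I x)]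

/-- The function `g(X, Y)`. -/
def metricFun (X Y : Π x : M, TangentSpace I x) (x : M) : ℝ :=
  inner ℝ (X x) (Y x)

/-- The right-hand side of the Koszul formula for `2 g(∇_X Y, Z)`. -/
def koszul (X Y Z : Π x : M, TangentSpace I x) (x : M) : ℝ :=
  derivAlong I X (metricFun I Y Z) x + derivAlong I Y (metricFun I X Z) x
    - derivAlong I Z (metricFun I X Y) x
    + metricFun I (mlieBracket I X Y) Z x
    - metricFun I (mlieBracket I X Z) Y x
    - metricFun I (mlieBracket I Y Z) X x

instance finiteDimensional_tangentSpace [FiniteDimensional ℝ E] (x : M) :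
    FiniteDimensional ℝ (TangentSpace I x) :=
  inferInstanceAs (FiniteDimensional ℝ E)

variable {I} in
theorem mdifferentiableAt_metricFun [IsManifold I ∞ M]
    [IsContMDiffRiemannianBundle I ∞ E (fun x : M ↦ TangentSpace I x)]
    {X Y : Π x : M, TangentSpace I x} {x : M}
    (hX : MDiffAt (T% X) x) (hY : MDiffAt (T% Y) x) : MDiffAt (metricFun I X Y) x :=
  MDifferentiableAt.inner_bundle (IB := I) (IM := I) (F := E) (E := fun x : M ↦ TangentSpace I x)
    (b := fun x ↦ x) hX hY

variable [FiniteDimensional ℝ E] [IsManifold I ∞ M]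

/-- The Levi-Civita connection: `∇_X Y` at `x` is the vector with
`g(∇_X Y, e) = (1/2) koszul X Y e`, written out in a `g`-orthonormal basis of the tangent space
at `x`, whose members are extended to vector fields. The choices are immaterial: see
`two_mul_inner_leviCivita`. -/
def leviCivita (X Y : Π x : M, TangentSpace I x) (x : M) : TangentSpace I x :=
  ∑ i, (koszul I X Y (FiberBundle.extend E (stdOrthonormalBasis ℝ (TangentSpace I x) i)) x / 2) •
    stdOrthonormalBasis ℝ (TangentSpace I x) i

/-- `R_{XY} Z = ∇_X ∇_Y Z - ∇_Y ∇_X Z - ∇_{[X,Y]} Z`. -/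
def curvature (X Y Z : Π x : M, TangentSpace I x) (x : M) : TangentSpace I x :=
  leviCivita I X (leviCivita I Y Z) x - leviCivita I Y (leviCivita I X Z) x
    - leviCivita I (mlieBracket I X Y) Z x

/-- The Riemann-Christoffel tensor `R(X, Y, Z, W) = -g(R_{XY} Z, W)`. -/
def riemann (X Y Z W : Π x : M, TangentSpace I x) (x : M) : ℝ :=
  -metricFun I (curvature I X Y Z) W x

variable [IsContMDiffRiemannianBundle I ∞ E (fun x : M ↦ TangentSpace I x)]

variable {I} in
theorem tensorialAt_koszul {X Y : Π x : M, TangentSpace I x} {x : M}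
    (hX : MDiffAt (T% X) x) (hY : MDiffAt (T% Y) x) :
    TensorialAt I E (koszul I X Y · x) x where
  smul {f Z} hf hZ := by
    have h1 : metricFun I Y (f • Z) = fun y ↦ f y * metricFun I Y Z y := by
      ext y; simp [metricFun, inner_smul_right]
    have h2 : metricFun I X (f • Z) = fun y ↦ f y * metricFun I X Z y := by
      ext y; simp [metricFun, inner_smul_right]
    have h3 : MDiffAt (metricFun I Y Z) x := mdifferentiableAt_metricFun hY hZ
    have h4 : MDiffAt (metricFun I X Z) x := mdifferentiableAt_metricFun hX hZ
    simp only [koszul, derivAlong, h1, h2]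
    rw [mvfderiv_fun_mul hf h3, mvfderiv_fun_mul hf h4]
    simp [metricFun, mlieBracket_smul_right hf hZ, inner_add_left, inner_smul_left,
      inner_smul_right, real_inner_comm]
    ring
  add {Z Z'} hZ hZ' := by
    have h1 : metricFun I Y (Z + Z') = fun y ↦ metricFun I Y Z y + metricFun I Y Z' y := by
      ext y; simp [metricFun, inner_add_right]
    have h2 : metricFun I X (Z + Z') = fun y ↦ metricFun I X Z y + metricFun I X Z' y := by
      ext y; simp [metricFun, inner_add_right]
    have h3 : MDiffAt (metricFun I Y Z) x := mdifferentiableAt_metricFun hY hZ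
    have h4 : MDiffAt (metricFun I X Z) x := mdifferentiableAt_metricFun hX hZ
    have h3' : MDiffAt (metricFun I Y Z') x := mdifferentiableAt_metricFun hY hZ'
    have h4' : MDiffAt (metricFun I X Z') x := mdifferentiableAt_metricFun hX hZ'
    simp only [koszul, derivAlong, h1, h2]
    rw [mvfderiv_fun_add h3 h3', mvfderiv_fun_add h4 h4']
    simp [metricFun, mlieBracket_add_right hZ hZ', inner_add_left, inner_add_right]
    ring

variable {I} in
/-- The Koszul formula. -/
theorem two_mul_inner_leviCivita {X Y Z : Π x : M, TangentSpace I x} {x : M}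
    (hX : MDiffAt (T% X) x) (hY : MDiffAt (T% Y) x) (hZ : MDiffAt (T% Z) x) :
    2 * inner ℝ (leviCivita I X Y x) (Z x) = koszul I X Y Z x := by
  have hT := tensorialAt_koszul hX hY
  rw [← TensorialAt.mkHom_apply hT hZ]
  conv_rhs => rw [← (stdOrthonormalBasis ℝ (TangentSpace I x)).sum_repr (Z x)]
  rw [map_sum, leviCivita, sum_inner, Finset.mul_sum]
  refine Finset.sum_congr rfl fun i _ ↦ ?_
  rw [map_smul, TensorialAt.mkHom_apply_eq_extend, inner_smul_left, OrthonormalBasis.repr_apply_apply]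
  simp
  ring

variable {I} in
/-- `∇` is torsion-free. -/
theorem leviCivita_sub_leviCivita {X Y : Π x : M, TangentSpace I x} {x : M}
    (hX : MDiffAt (T% X) x) (hY : MDiffAt (T% Y) x) :
    leviCivita I X Y x - leviCivita I Y X x = mlieBracket I X Y x := by
  refine ext_inner_right ℝ fun z ↦ ?_
  have hZ := FiberBundle.extend_apply_self E z
  have hdZ := FiberBundle.mdifferentiableAt_extend I E z
  have h1 := two_mul_inner_leviCivita hX hY hdZ
  have h2 := two_mul_inner_leviCivita hY hX hdZ
  have h3 : metricFun I X Y = metricFun I Y X := by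
    ext y; simp [metricFun, real_inner_comm]
  simp only [koszul, metricFun, hZ, h3, mlieBracket_swap_apply (V := Y) (W := X),
    inner_neg_left] at h1 h2
  rw [inner_sub_left]
  linarith

variable {I} in
/-- `∇` is metric. -/
theorem derivAlong_metricFun {X Y Z : Π x : M, TangentSpace I x} {x : M}
    (hX : MDiffAt (T% X) x) (hY : MDiffAt (T% Y) x) (hZ : MDiffAt (T% Z) x) :
    derivAlong I X (metricFun I Y Z) x =
      metricFun I (leviCivita I X Y) Z x + metricFun I Y (leviCivita I X Z) x := by
  have h1 := two_mul_inner_leviCivita hX hY hZ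
  have h2 := two_mul_inner_leviCivita hX hZ hY
  have hc (U V : Π x : M, TangentSpace I x) : metricFun I U V = metricFun I V U := by
    ext y; simp [metricFun, real_inner_comm]
  have h3 : metricFun I (mlieBracket I Y Z) X x = -metricFun I (mlieBracket I Z Y) X x := by
    simp [metricFun, mlieBracket_swap_apply (V := Y) (W := Z)]
  rw [hc Y (leviCivita I X Z)]
  simp only [koszul, h3, hc Z Y] at h1 h2
  simp only [metricFun] at h1 h2 ⊢
  linarith

end LeviCivita

/-! ### Almost contact metric structures and the curvature identities -/

section AlmostContact

variable {E : Type*} [NormedAddCommGroup E] [NormedSpace ℝ E] [FiniteDimensional ℝ E]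
  {H : Type*} [TopologicalSpace H] (I : ModelWithCorners ℝ E H)
  (M : Type*) [TopologicalSpace M] [ChartedSpace H M] [IsManifold I ∞ M]
  [RiemannianBundle (fun x : M ↦ TangentSpace I x)]

/-- An almost contact structure `(φ, ξ, η)` compatible with the Riemannian metric `g` of `M`. -/
structure AlmostContactMetricStructure where
  /-- the endomorphism field -/
  phi : Π x : M, TangentSpace I x →L[ℝ] TangentSpace I x
  /-- the characteristic vector field -/
  xi : Π x : M, TangentSpace I x
  /-- the 1-form -/
  eta : Π x : M, TangentSpace I x →L[ℝ] ℝ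
  contMDiff_phi : ContMDiff I (I.prod 𝓘(ℝ, E →L[ℝ] E)) ∞
    (fun x ↦ TotalSpace.mk' (E →L[ℝ] E)
      (E := fun x : M ↦ TangentSpace I x →L[ℝ] TangentSpace I x) x (phi x))
  contMDiff_xi : ContMDiff I (I.prod 𝓘(ℝ, E)) ∞
    (fun x ↦ TotalSpace.mk' E (E := fun x : M ↦ TangentSpace I x) x (xi x))
  contMDiff_eta : ContMDiff I (I.prod 𝓘(ℝ, E →L[ℝ] ℝ)) ∞
    (fun x ↦ TotalSpace.mk' (E →L[ℝ] ℝ)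
      (E := fun x : M ↦ TangentSpace I x →L[ℝ] ℝ) x (eta x))
  phi_phi : ∀ (x : M) (v : TangentSpace I x), phi x (phi x v) = -v + eta x v • xi x
  eta_xi : ∀ x : M, eta x (xi x) = 1
  inner_phi_phi : ∀ (x : M) (v w : TangentSpace I x),
    inner ℝ (phi x v) (phi x w) = inner ℝ v w - eta x v * eta x w

variable {M}

/-- `X` is a smooth vector field on `M`, i.e. `X ∈ χ(M)`. -/
def IsSmoothField (X : Π x : M, TangentSpace I x) : Prop :=
  ContMDiff I (I.prod 𝓘(ℝ, E)) ∞
    (fun x ↦ TotalSpace.mk' E (E := fun x : M ↦ TangentSpace I x) x (X x))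

namespace AlmostContactMetricStructure

variable {I} (S : AlmostContactMetricStructure I M)

/-- The vector field `φ X`. -/
def phiField (X : Π x : M, TangentSpace I x) (x : M) : TangentSpace I x := S.phi x (X x)

/-- The function `η(X)`. -/
def etaFun (X : Π x : M, TangentSpace I x) (x : M) : ℝ := S.eta x (X x)

local notation "𝐠" => metricFun I
local notation "𝐑" => riemann I

/-- The identity (G1). -/
def SatisfiesG1 : Prop :=
  ∀ X Y Z W : Π x : M, TangentSpace I x,
    IsSmoothField I X → IsSmoothField I Y → IsSmoothField I Z → IsSmoothField I W →
    ∀ p : M,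
      𝐑 X Y (S.phiField Z) (S.phiField W) p - 𝐑 X Y Z W p =
        𝐠 Y (S.phiField W) p * 𝐠 X (S.phiField Z) p
        - 𝐠 X (S.phiField W) p * 𝐠 Y (S.phiField Z) p
        + 𝐠 X W p * 𝐠 Y Z p - 𝐠 Y W p * 𝐠 X Z p

/-- The identity (G2). -/
def SatisfiesG2 : Prop :=
  ∀ X Y Z W : Π x : M, TangentSpace I x,
    IsSmoothField I X → IsSmoothField I Y → IsSmoothField I Z → IsSmoothField I W →
    ∀ p : M,
      𝐑 X Y Z W p =
        𝐑 (S.phiField X) Y Z (S.phiField W) p + 𝐑 X (S.phiField Y) Z (S.phiField W) p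
        + 𝐑 X Y (S.phiField Z) (S.phiField W) p
        + 𝐠 X Z p * S.etaFun W p * S.etaFun Y p - 𝐠 Z Y p * S.etaFun X p * S.etaFun W p

/-- The identity (G3). -/
def SatisfiesG3 : Prop :=
  ∀ X Y Z W : Π x : M, TangentSpace I x,
    IsSmoothField I X → IsSmoothField I Y → IsSmoothField I Z → IsSmoothField I W →
    ∀ p : M,
      𝐑 X Y Z W p =
        𝐑 (S.phiField X) (S.phiField Y) (S.phiField Z) (S.phiField W) p
        + 𝐠 X Z p * S.etaFun W p * S.etaFun Y p - 𝐠 Z Y p * S.etaFun X p * S.etaFun W p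
        + 𝐠 Y W p * S.etaFun X p * S.etaFun Z p - 𝐠 X W p * S.etaFun Y p * S.etaFun Z p

end AlmostContactMetricStructure

end AlmostContact

/-! ### Classes of almost contact metric manifolds -/

/-- An almost contact metric manifold `(M, φ, ξ, η, g)`: a smooth Hausdorff manifold without
boundary of dimension `2n + 1`, with a smooth Riemannian metric and a compatible almost contact
structure. -/
structure AlmostContactMetricManifold where
  /-- the dimension is `2 * n + 1` -/
  n : ℕ
  /-- the underlying set `M` -/
  carrier : Type u
  [topologicalSpace : TopologicalSpace carrier]
  [t2Space : T2Space carrier]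
  [chartedSpace : ChartedSpace (EuclideanSpace ℝ (Fin (2 * n + 1))) carrier]
  [isManifold : IsManifold (𝓡 (2 * n + 1)) ∞ carrier]
  [riemannianBundle : RiemannianBundle (fun x : carrier ↦ TangentSpace (𝓡 (2 * n + 1)) x)]
  [isContMDiffRiemannianBundle : IsContMDiffRiemannianBundle (𝓡 (2 * n + 1)) ∞
    (EuclideanSpace ℝ (Fin (2 * n + 1))) (fun x : carrier ↦ TangentSpace (𝓡 (2 * n + 1)) x)]
  /-- the tensors `(φ, ξ, η)` -/
  str : AlmostContactMetricStructure (𝓡 (2 * n + 1)) carrier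

attribute [instance] AlmostContactMetricManifold.topologicalSpace
  AlmostContactMetricManifold.t2Space AlmostContactMetricManifold.chartedSpace
  AlmostContactMetricManifold.isManifold AlmostContactMetricManifold.riemannianBundle
  AlmostContactMetricManifold.isContMDiffRiemannianBundle

namespace AlmostContactMetricManifold

/-- The subclass of the manifolds in `L` that satisfy (G1). -/
def subclassG1 (L : Set AlmostContactMetricManifold.{u}) : Set AlmostContactMetricManifold.{u} :=
  {N | N ∈ L ∧ N.str.SatisfiesG1}

/-- The subclass of the manifolds in `L` that satisfy (G2). -/
def subclassG2 (L : Set AlmostContactMetricManifold.{u}) : Set AlmostContactMetricManifold.{u} :=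
  {N | N ∈ L ∧ N.str.SatisfiesG2}

/-- The subclass of the manifolds in `L` that satisfy (G3). -/
def subclassG3 (L : Set AlmostContactMetricManifold.{u}) : Set AlmostContactMetricManifold.{u} :=
  {N | N ∈ L ∧ N.str.SatisfiesG3}

end AlmostContactMetricManifold

end

section SmoothFields

open Filter Topology

variable {E : Type*} [NormedAddCommGroup E] [NormedSpace ℝ E]
  {H : Type*} [TopologicalSpace H] {I : ModelWithCorners ℝ E H}
  {M : Type*} [TopologicalSpace M] [ChartedSpace H M]

theorem contMDiffAt_matrix_det {ι : Type*} [Fintype ι] [DecidableEq ι] {n : ℕ∞ω}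
    {A : M → Matrix ι ι ℝ} {x : M} (hA : ∀ i j, CMDiffAt n (fun y ↦ A y i j) x) :
    CMDiffAt n (fun y ↦ (A y).det) x := by
  simp only [Matrix.det_apply']
  exact ContMDiffAt.sum fun σ _ ↦ contMDiffAt_const.mul (ContMDiffAt.prod fun i _ ↦ hA _ _)

/-- Solutions of a nonsingular linear system with smooth coefficients are smooth. -/
theorem contMDiffAt_of_mulVec {ι : Type*} [Fintype ι] [DecidableEq ι] {n : ℕ∞ω}
    {A : M → Matrix ι ι ℝ} {b c : M → ι → ℝ} {x : M}
    (hA : ∀ i j, CMDiffAt n (fun y ↦ A y i j) x) (hb : ∀ i, CMDiffAt n (fun y ↦ b y i) x)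
    (hdet : (A x).det ≠ 0) (hc : ∀ᶠ y in 𝓝 x, (A y).mulVec (c y) = b y) (i : ι) :
    CMDiffAt n (fun y ↦ c y i) x := by
  have hd : CMDiffAt n (fun y ↦ (A y).det) x := contMDiffAt_matrix_det hA
  have hcr : CMDiffAt n (fun y ↦ (A y).cramer (b y) i) x := by
    simp only [Matrix.cramer_apply]
    refine contMDiffAt_matrix_det fun j k ↦ ?_
    by_cases hk : k = i
    · simpa [Matrix.updateCol_apply, hk] using hb j
    · simpa [Matrix.updateCol_apply, hk] using hA j k
  have h : CMDiffAt n (fun y ↦ (A y).cramer (b y) i * ((A y).det)⁻¹) x :=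
    hcr.mul (hd.inv₀ hdet)
  refine h.congr_of_eventuallyEq ?_
  filter_upwards [hc, hd.continuousAt.eventually_ne hdet] with y hy hy'
  rw [← hy, Matrix.cramer_eq_adjugate_mulVec, Matrix.mulVec_mulVec, Matrix.adjugate_mul,
    Matrix.smul_mulVec, Matrix.one_mulVec, Pi.smul_apply, smul_eq_mul]
  field_simp

variable [IsManifold I ∞ M]

theorem ContMDiffAt.derivAlong {X : Π x : M, TangentSpace I x} {f : M → ℝ} {x : M}
    (hX : CMDiffAt ∞ (T% X) x) (hf : CMDiffAt ∞ f x) :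
    CMDiffAt ∞ (derivAlong I X f) x := by
  have h1 := hf.mfderiv_const (m := ∞) le_rfl
  have h2 := ContMDiffAt.clm_apply_of_inCoordinates (B₂ := ℝ)
    (E₂ := fun y : ℝ ↦ TangentSpace 𝓘(ℝ, ℝ) y) h1 hX hf
  rw [contMDiffAt_totalSpace] at h2
  refine h2.2.congr_of_eventuallyEq (.of_forall fun y ↦ ?_)
  simp [_root_.derivAlong, mvfderiv, mfld_simps]
  rfl

theorem ContMDiffAt.mlieBracket_infty [FiniteDimensional ℝ E]
    {X Y : Π x : M, TangentSpace I x} {x : M}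
    (hX : CMDiffAt ∞ (T% X) x) (hY : CMDiffAt ∞ (T% Y) x) :
    CMDiffAt ∞ (T% (mlieBracket I X Y)) x := by
  have := FiniteDimensional.complete ℝ E
  have : IsManifold I (minSmoothness ℝ 2) M := by simpa using! inferInstanceAs (IsManifold I 2 M)
  have : IsManifold I (((⊤ : ℕ∞) : ℕ∞ω) + 1) M := inferInstanceAs (IsManifold I ∞ M)
  exact ContMDiffAt.mlieBracket_vectorField (m := ⊤) (n := ⊤) hX hY (by simp)

variable [RiemannianBundle (fun x : M ↦ TangentSpace I x)]
  [IsContMDiffRiemannianBundle I ∞ E (fun x : M ↦ TangentSpace I x)]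

theorem ContMDiffAt.metricFun {X Y : Π x : M, TangentSpace I x} {x : M}
    (hX : CMDiffAt ∞ (T% X) x) (hY : CMDiffAt ∞ (T% Y) x) :
    CMDiffAt ∞ (metricFun I X Y) x :=
  ContMDiffAt.inner_bundle (IB := I) (IM := I) (F := E) (E := fun x : M ↦ TangentSpace I x)
    (b := fun x ↦ x) hX hY

variable [FiniteDimensional ℝ E]

theorem ContMDiffAt.koszul {X Y Z : Π x : M, TangentSpace I x} {x : M}
    (hX : CMDiffAt ∞ (T% X) x) (hY : CMDiffAt ∞ (T% Y) x) (hZ : CMDiffAt ∞ (T% Z) x) :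
    CMDiffAt ∞ (koszul I X Y Z) x :=
  (((((hX.derivAlong (hY.metricFun hZ)).add (hY.derivAlong (hX.metricFun hZ))).sub
    (hZ.derivAlong (hX.metricFun hY))).add ((hX.mlieBracket_infty hY).metricFun hZ)).sub
    ((hX.mlieBracket_infty hZ).metricFun hY)).sub ((hY.mlieBracket_infty hZ).metricFun hX)

/-- A vector field is smooth if its inner products with smooth vector fields are. -/
theorem contMDiffAt_of_metricFun {V : Π x : M, TangentSpace I x} {x : M}
    (h : ∀ Z : Π x : M, TangentSpace I x, CMDiffAt ∞ (T% Z) x → CMDiffAt ∞ (metricFun I V Z) x) :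
    CMDiffAt ∞ (T% V) x := by
  classical
  let b := Module.finBasis ℝ E
  let e := trivializationAt E (TangentSpace I : M → Type _) x
  have hx : x ∈ e.baseSet := FiberBundle.mem_baseSet_trivializationAt' x
  have hs (i) : CMDiffAt ∞ (T% (e.localFrame b i)) x := contMDiffAt_localFrame_of_mem ∞ e b i hx
  have : ContMDiffVectorBundle 1 E (TangentSpace I : M → Type _) I := inferInstance
  rw [contMDiffAt_iff_localFrameCoeff (e := e) b hx]
  refine contMDiffAt_of_mulVec (b := fun y i ↦ metricFun I V (e.localFrame b i) y)
    (c := fun y i ↦ e.localFrameCoeff I b i y (V y))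
    (A := fun y ↦ Matrix.gram ℝ fun i ↦ e.localFrame b i y) ?_ ?_ ?_ ?_
  · exact fun i j ↦ (hs i).metricFun (hs j)
  · exact fun i ↦ h _ (hs i)
  · rw [Matrix.det_gram_ne_zero_iff_linearIndependent]
    exact (e.isLocalFrameOn_localFrame_baseSet I ∞ b).linearIndependent hx
  · filter_upwards [e.open_baseSet.mem_nhds hx] with y hy
    ext i
    simp only [metricFun]
    conv_rhs => rw [e.eq_sum_localFrameCoeff_smul (I := I) (b := b) (s := V) hy]
    rw [sum_inner, Matrix.mulVec, dotProduct]
    refine Finset.sum_congr rfl fun j _ ↦ ?_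
    rw [inner_smul_left, Matrix.gram_apply, real_inner_comm, mul_comm]
    rfl

end SmoothFields

section CurvatureSymmetries

open Filter Topology

variable {E : Type*} [NormedAddCommGroup E] [NormedSpace ℝ E]
  {H : Type*} [TopologicalSpace H] {I : ModelWithCorners ℝ E H}
  {M : Type*} [TopologicalSpace M] [ChartedSpace H M]

theorem metricFun_comm [RiemannianBundle (fun x : M ↦ TangentSpace I x)]
    (X Y : Π x : M, TangentSpace I x) : metricFun I X Y = metricFun I Y X := by
  ext x
  exact real_inner_comm _ _

variable [IsManifold I ∞ M]

theorem IsSmoothField.mdifferentiableAt {X : Π x : M, TangentSpace I x}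
    (hX : IsSmoothField I X) (x : M) : MDiffAt (T% X) x :=
  (hX x).mdifferentiableAt (by simp)

theorem eventually_mdifferentiableAt_vectorField {X : Π x : M, TangentSpace I x} {x : M}
    (hX : CMDiffAt ∞ (T% X) x) : ∀ᶠ y in 𝓝 x, MDiffAt (T% X) y := by
  have h : CMDiffAt 1 (T% X) x := hX.of_le (by simp)
  filter_upwards [(contMDiffAt_iff_contMDiffAt_nhds (by simp)).1 h] with y hy
  exact hy.mdifferentiableAt (by simp)

variable [FiniteDimensional ℝ E]

theorem isSmoothField_mlieBracket {X Y : Π x : M, TangentSpace I x}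
    (hX : IsSmoothField I X) (hY : IsSmoothField I Y) : IsSmoothField I (mlieBracket I X Y) :=
  fun x ↦ (hX x).mlieBracket_infty (hY x)

/-- The Jacobi identity for smooth vector fields. -/
theorem jacobi_mlieBracket {X Y Z : Π x : M, TangentSpace I x} {x : M}
    (hX : CMDiffAt ∞ (T% X) x) (hY : CMDiffAt ∞ (T% Y) x) (hZ : CMDiffAt ∞ (T% Z) x) :
    mlieBracket I X (mlieBracket I Y Z) x =
      mlieBracket I (mlieBracket I X Y) Z x + mlieBracket I Y (mlieBracket I X Z) x := by
  have := FiniteDimensional.complete ℝ E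
  have : IsManifold I (minSmoothness ℝ 3) M := by simpa using! inferInstanceAs (IsManifold I 3 M)
  have hs {U : Π x : M, TangentSpace I x} (hU : CMDiffAt ∞ (T% U) x) :
      CMDiffAt (minSmoothness ℝ 2) (T% U) x :=
    hU.of_le (by rw [minSmoothness_of_isRCLikeNormedField]; exact ENat.LEInfty.out)
  exact leibniz_identity_mlieBracket_apply (hs hX) (hs hY) (hs hZ)

theorem mlieBracket_mlieBracket_smul {X Y Z : Π x : M, TangentSpace I x} {f : M → ℝ} {x : M}
    (hY : CMDiffAt ∞ (T% Y) x) (hZ : CMDiffAt ∞ (T% Z) x) (hf : CMDiffAt ∞ f x) :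
    mlieBracket I X (mlieBracket I Y (f • Z)) x =
      derivAlong I X (derivAlong I Y f) x • Z x + derivAlong I Y f x • mlieBracket I X Z x
        + (derivAlong I X f x • mlieBracket I Y Z x
          + f x • mlieBracket I X (mlieBracket I Y Z) x) := by
  have := FiniteDimensional.complete ℝ E
  have : IsManifold I 2 M := inferInstance
  have h1 : mlieBracket I Y (f • Z) =ᶠ[𝓝 x] derivAlong I Y f • Z + f • mlieBracket I Y Z := by
    have hf1 : CMDiffAt 1 f x := hf.of_le (by simp)
    filter_upwards [(contMDiffAt_iff_contMDiffAt_nhds (by simp)).1 hf1,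
      eventually_mdifferentiableAt_vectorField hZ] with y hfy hZy
    exact mlieBracket_smul_right (hfy.mdifferentiableAt (by simp)) hZy
  have hYf : MDiffAt (derivAlong I Y f) x := (hY.derivAlong hf).mdifferentiableAt (by simp)
  have hf' : MDiffAt f x := hf.mdifferentiableAt (by simp)
  have hZ' : MDiffAt (T% Z) x := hZ.mdifferentiableAt (by simp)
  have hYZ : MDiffAt (T% (mlieBracket I Y Z)) x :=
    (hY.mlieBracket_infty hZ).mdifferentiableAt (by simp)
  rw [EventuallyEq.mlieBracket_vectorField_eq (V := X) .rfl h1,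
    mlieBracket_add_right (hYf.smul_section hZ') (hf'.smul_section hYZ),
    mlieBracket_smul_right hYf hZ', mlieBracket_smul_right hf' hYZ]
  rfl

/-- `[X, Y] f = X (Y f) - Y (X f)`. -/
theorem derivAlong_mlieBracket {X Y : Π x : M, TangentSpace I x} {f : M → ℝ} {x : M}
    (hX : CMDiffAt ∞ (T% X) x) (hY : CMDiffAt ∞ (T% Y) x) (hf : CMDiffAt ∞ f x) :
    derivAlong I (mlieBracket I X Y) f x =
      derivAlong I X (derivAlong I Y f) x - derivAlong I Y (derivAlong I X f) x := by
  have := FiniteDimensional.complete ℝ E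
  have : IsManifold I 2 M := inferInstance
  obtain h | ⟨v, hv⟩ := forall_or_exists_not fun v : TangentSpace I x ↦ v = 0
  · simp [derivAlong, h]
  set Z : Π x : M, TangentSpace I x := FiberBundle.extend E v
  have hZ : CMDiffAt ∞ (T% Z) x := FiberBundle.contMDiffAt_extend I E v
  have hZx : Z x = v := FiberBundle.extend_apply_self E v
  have h1 := jacobi_mlieBracket hX hY (hf.smul_section hZ)
  have h2 := jacobi_mlieBracket hX hY hZ
  rw [mlieBracket_mlieBracket_smul hY hZ hf, mlieBracket_mlieBracket_smul hX hZ hf,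
    mlieBracket_smul_right (hf.mdifferentiableAt (by simp)) (hZ.mdifferentiableAt (by simp)),
    h2, hZx] at h1
  change _ = derivAlong I (mlieBracket I X Y) f x • v + _ + _ at h1
  have h3 : (derivAlong I (mlieBracket I X Y) f x -
      (derivAlong I X (derivAlong I Y f) x - derivAlong I Y (derivAlong I X f) x)) • v = 0 := by
    linear_combination (norm := module) -h1
  exact sub_eq_zero.1 ((smul_eq_zero.1 h3).resolve_right hv)

variable [RiemannianBundle (fun x : M ↦ TangentSpace I x)]

theorem leviCivita_neg_left {X Y : Π x : M, TangentSpace I x} {x : M}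
    (hX : MDiffAt (T% X) x) :
    leviCivita I (-X) Y x = -leviCivita I X Y x := by
  have := FiniteDimensional.complete ℝ E
  have : IsManifold I 2 M := inferInstance
  have hneg : -X = (-1 : ℝ) • X := by simp
  have hl (U : Π x : M, TangentSpace I x) : mlieBracket I (-X) U x = -mlieBracket I X U x := by
    rw [hneg, mlieBracket_const_smul_left hX, neg_one_smul]
  have hm (U : Π x : M, TangentSpace I x) : metricFun I (-X) U = -metricFun I X U := by
    ext y
    simp [metricFun]
  have hk (Z : Π x : M, TangentSpace I x) : koszul I (-X) Y Z x = -koszul I X Y Z x := by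
    simp only [koszul, derivAlong, hm, mvfderiv_neg]
    simp [metricFun, hl]
    ring
  simp [leviCivita, hk, neg_div]

theorem curvature_swap {X Y : Π x : M, TangentSpace I x} (hX : IsSmoothField I X)
    (hY : IsSmoothField I Y) (Z : Π x : M, TangentSpace I x) (x : M) :
    curvature I X Y Z x = -curvature I Y X Z x := by
  rw [curvature, curvature, mlieBracket_swap,
    leviCivita_neg_left ((isSmoothField_mlieBracket hY hX).mdifferentiableAt x)]
  abel

theorem riemann_swap_left {X Y : Π x : M, TangentSpace I x} (hX : IsSmoothField I X)
    (hY : IsSmoothField I Y) (Z W : Π x : M, TangentSpace I x) (x : M) :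
    riemann I X Y Z W x = -riemann I Y X Z W x := by
  simp [riemann, metricFun, curvature_swap hX hY]

variable [IsContMDiffRiemannianBundle I ∞ E (fun x : M ↦ TangentSpace I x)]

theorem ContMDiffAt.leviCivita {X Y : Π x : M, TangentSpace I x} {x : M}
    (hX : CMDiffAt ∞ (T% X) x) (hY : CMDiffAt ∞ (T% Y) x) :
    CMDiffAt ∞ (T% (leviCivita I X Y)) x := by
  refine contMDiffAt_of_metricFun fun Z hZ ↦ ?_
  have h : CMDiffAt ∞ (fun y ↦ (1 / 2 : ℝ) * _root_.koszul I X Y Z y) x :=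
    contMDiffAt_const.mul (hX.koszul hY hZ)
  refine h.congr_of_eventuallyEq ?_
  filter_upwards [eventually_mdifferentiableAt_vectorField hX,
    eventually_mdifferentiableAt_vectorField hY,
    eventually_mdifferentiableAt_vectorField hZ] with y h1 h2 h3
  rw [← two_mul_inner_leviCivita h1 h2 h3, _root_.metricFun]
  ring

theorem IsSmoothField.leviCivita {X Y : Π x : M, TangentSpace I x}
    (hX : IsSmoothField I X) (hY : IsSmoothField I Y) : IsSmoothField I (leviCivita I X Y) :=
  fun x ↦ (hX x).leviCivita (hY x)

theorem derivAlong_derivAlong_metricFun {X Y Z W : Π x : M, TangentSpace I x}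
    (hX : IsSmoothField I X) (hY : IsSmoothField I Y) (hZ : IsSmoothField I Z)
    (hW : IsSmoothField I W) (x : M) :
    derivAlong I X (derivAlong I Y (metricFun I Z W)) x =
      metricFun I (leviCivita I X (leviCivita I Y Z)) W x
      + metricFun I (leviCivita I Y Z) (leviCivita I X W) x
      + (metricFun I (leviCivita I X Z) (leviCivita I Y W) x
      + metricFun I Z (leviCivita I X (leviCivita I Y W)) x) := by
  have h1 : derivAlong I Y (metricFun I Z W) =
      metricFun I (leviCivita I Y Z) W + metricFun I Z (leviCivita I Y W) := by
    ext y
    exact derivAlong_metricFun (hY.mdifferentiableAt y) (hZ.mdifferentiableAt y)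
      (hW.mdifferentiableAt y)
  have hYZ := hY.leviCivita hZ
  have hYW := hY.leviCivita hW
  rw [h1, ← derivAlong_metricFun (hX.mdifferentiableAt x) (hYZ.mdifferentiableAt x)
    (hW.mdifferentiableAt x), ← derivAlong_metricFun (hX.mdifferentiableAt x)
    (hZ.mdifferentiableAt x) (hYW.mdifferentiableAt x)]
  simp only [derivAlong]
  rw [mvfderiv_add]
  · rfl
  · exact mdifferentiableAt_metricFun (hYZ.mdifferentiableAt x) (hW.mdifferentiableAt x)
  · exact mdifferentiableAt_metricFun (hZ.mdifferentiableAt x) (hYW.mdifferentiableAt x)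

theorem riemann_swap_right {X Y Z W : Π x : M, TangentSpace I x}
    (hX : IsSmoothField I X) (hY : IsSmoothField I Y) (hZ : IsSmoothField I Z)
    (hW : IsSmoothField I W) (x : M) :
    riemann I X Y Z W x = -riemann I X Y W Z x := by
  have h1 := derivAlong_derivAlong_metricFun hX hY hZ hW x
  have h2 := derivAlong_derivAlong_metricFun hY hX hZ hW x
  have h3 := derivAlong_mlieBracket (hX x) (hY x) ((hZ x).metricFun (hW x))
  have h4 := derivAlong_metricFun ((isSmoothField_mlieBracket hX hY).mdifferentiableAt x)
    (hZ.mdifferentiableAt x) (hW.mdifferentiableAt x)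
  rw [metricFun_comm Z, metricFun_comm Z] at *
  simp only [riemann, curvature, metricFun, inner_sub_left] at *
  simp only [real_inner_comm] at *
  linarith

theorem leviCivita_sub_right {X Y Z : Π x : M, TangentSpace I x} {x : M}
    (hX : MDiffAt (T% X) x) (hY : MDiffAt (T% Y) x) (hZ : MDiffAt (T% Z) x) :
    leviCivita I X (Y - Z) x = leviCivita I X Y x - leviCivita I X Z x := by
  refine ext_inner_right ℝ fun w ↦ ?_
  have hW := FiberBundle.extend_apply_self E w
  have hdW := FiberBundle.mdifferentiableAt_extend I E w
  set W : Π x : M, TangentSpace I x := FiberBundle.extend E w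
  have h : metricFun I (Y - Z) W = metricFun I Y W - metricFun I Z W := by
    ext y
    simp [metricFun, inner_sub_left]
  have h1 := derivAlong_metricFun hX (mdifferentiableAt_sub_section hY hZ) hdW
  have h2 := derivAlong_metricFun hX hY hdW
  have h3 := derivAlong_metricFun hX hZ hdW
  simp only [derivAlong] at h1 h2 h3
  rw [h, mvfderiv_sub (mdifferentiableAt_metricFun hY hdW)
    (mdifferentiableAt_metricFun hZ hdW)] at h1
  simp only [sub_apply, h2, h3, metricFun, hW, Pi.sub_apply,
    inner_sub_left] at h1
  rw [inner_sub_left]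
  linarith

/-- The first Bianchi identity. -/
theorem curvature_cyclic_sum {X Y Z : Π x : M, TangentSpace I x}
    (hX : IsSmoothField I X) (hY : IsSmoothField I Y) (hZ : IsSmoothField I Z) (x : M) :
    curvature I X Y Z x + curvature I Y Z X x + curvature I Z X Y x = 0 := by
  have key {X Y Z : Π x : M, TangentSpace I x} (hX : IsSmoothField I X) (hY : IsSmoothField I Y)
      (hZ : IsSmoothField I Z) : leviCivita I X (leviCivita I Y Z) x
        - leviCivita I X (leviCivita I Z Y) x - leviCivita I (mlieBracket I Y Z) X x
        = mlieBracket I X (mlieBracket I Y Z) x := by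
    have h : mlieBracket I Y Z = leviCivita I Y Z - leviCivita I Z Y := by
      ext1 y
      exact (leviCivita_sub_leviCivita (hY.mdifferentiableAt y) (hZ.mdifferentiableAt y)).symm
    rw [← leviCivita_sub_leviCivita (hX.mdifferentiableAt x)
      ((isSmoothField_mlieBracket hY hZ).mdifferentiableAt x), ← leviCivita_sub_right
      (hX.mdifferentiableAt x) ((hY.leviCivita hZ).mdifferentiableAt x)
      ((hZ.leviCivita hY).mdifferentiableAt x), ← h]
  have h1 := key hX hY hZ
  have h2 := key hY hZ hX
  have h3 := key hZ hX hY
  have h4 := jacobi_mlieBracket (hX x) (hY x) (hZ x)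
  have h5 : mlieBracket I Y (mlieBracket I Z X) x = -mlieBracket I Y (mlieBracket I X Z) x := by
    have := FiniteDimensional.complete ℝ E
    have : IsManifold I 2 M := inferInstance
    have hn : mlieBracket I Z X = (-1 : ℝ) • mlieBracket I X Z := by
      rw [mlieBracket_swap, neg_one_smul]
    rw [hn, mlieBracket_const_smul_right ((isSmoothField_mlieBracket hX hZ).mdifferentiableAt x),
      neg_one_smul]
  have h6 := mlieBracket_swap_apply (I := I) (V := Z) (W := mlieBracket I X Y) (x := x)
  simp only [curvature]
  linear_combination (norm := module) h1 + h2 + h3 + h4 + h5 + h6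

theorem riemann_cyclic_sum {X Y Z : Π x : M, TangentSpace I x}
    (hX : IsSmoothField I X) (hY : IsSmoothField I Y) (hZ : IsSmoothField I Z)
    (W : Π x : M, TangentSpace I x) (x : M) :
    riemann I X Y Z W x + riemann I Y Z X W x + riemann I Z X Y W x = 0 := by
  have h := congrArg (fun v ↦ inner ℝ v (W x)) (curvature_cyclic_sum hX hY hZ x)
  simp only [inner_add_left, inner_zero_left] at h
  simp only [riemann, metricFun]
  linarith

/-- The pair symmetry of the curvature tensor. -/
theorem riemann_swap_pairs {X Y Z W : Π x : M, TangentSpace I x}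
    (hX : IsSmoothField I X) (hY : IsSmoothField I Y) (hZ : IsSmoothField I Z)
    (hW : IsSmoothField I W) (x : M) :
    riemann I X Y Z W x = riemann I Z W X Y x := by
  linarith [riemann_cyclic_sum hX hY hZ W x, riemann_cyclic_sum hY hZ hW X x,
    riemann_cyclic_sum hZ hW hX Y x, riemann_cyclic_sum hW hX hY Z x,
    riemann_swap_left hZ hX Y W x, riemann_swap_left hW hY Z X x,
    riemann_swap_right hX hY hZ hW x, riemann_swap_right hY hZ hX hW x,
    riemann_swap_right hX hZ hY hW x, riemann_swap_right hZ hW hX hY x,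
    riemann_swap_right hY hW hZ hX x, riemann_swap_right hW hX hY hZ x]

end CurvatureSymmetries

section GrayIdentities

variable {V : Type*} [AddCommGroup V] {T : V → V → V → V → ℝ} {φ N : V → V}

/-- For a curvature-like form, invariance under `φ` in the last two arguments implies the second
Gray identity. -/
theorem gray_two_of_gray_one (hpair : ∀ X Y Z W, T X Y Z W = T Z W X Y)
    (hadd : ∀ X Y Z W W', T X Y Z (W + W') = T X Y Z W + T X Y Z W')
    (hφφ : ∀ X, φ (φ X) + X = N X) (hφN : ∀ X, φ (N X) = 0)
    (h : ∀ X Y Z W, T X Y (φ Z) (φ W) = T X Y Z W) (X Y Z W : V) :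
    T X Y Z W = T (φ X) Y Z (φ W) + T X (φ Y) Z (φ W) + T X Y (φ Z) (φ W) := by
  have hzero (X Y Z) : T X Y Z 0 = 0 := by simpa using hadd X Y Z 0 0
  have hN (X Y Z W) : T X Y Z (N W) = 0 := by rw [← h, hφN, hzero]
  have hskew (X Y Z W) : T X Y (φ Z) W = -T X Y Z (φ W) := by
    have h1 := hadd X Y (φ Z) (φ (φ W)) W
    rw [hφφ, hN, h] at h1
    linarith
  have hleft : T (φ X) Y Z (φ W) = -T X (φ Y) Z (φ W) := by
    rw [hpair, hskew, hpair]
  rw [hleft, h]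
  ring

/-- For a curvature-like form, the second Gray identity implies the third one. -/
theorem gray_three_of_gray_two (hpair : ∀ X Y Z W, T X Y Z W = T Z W X Y)
    (hright : ∀ X Y Z W, T X Y Z W = -T X Y W Z)
    (hadd : ∀ X Y Z W W', T X Y Z (W + W') = T X Y Z W + T X Y Z W')
    (hφφ : ∀ X, φ (φ X) + X = N X) (hφN : ∀ X, φ (N X) = 0)
    (h : ∀ X Y Z W, T X Y Z W = T (φ X) Y Z (φ W) + T X (φ Y) Z (φ W) + T X Y (φ Z) (φ W))
    (X Y Z W : V) :
    T X Y Z W = T (φ X) (φ Y) (φ Z) (φ W) := by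
  have hzero (X Y Z) : T X Y Z 0 = 0 := by simpa using hadd X Y Z 0 0
  have hN (X Y Z W) : T X Y Z (N W) = 0 := by
    rw [h, hφN]
    simp [hzero]
  have h4 (X Y Z W) : T X Y Z (φ (φ W)) = -T X Y Z W := by
    have h1 := hadd X Y Z (φ (φ W)) W
    rw [hφφ, hN] at h1
    linarith
  have h3 (X Y Z W) : T X Y (φ (φ Z)) W = -T X Y Z W := by
    rw [hright, h4, hright X Y Z W]
  have h2 (X Y Z W) : T X (φ (φ Y)) Z W = -T X Y Z W := by
    rw [hpair, h4, hpair]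
  have h1 (X Y Z W) : T (φ (φ X)) Y Z W = -T X Y Z W := by
    rw [hpair, h3, hpair]
  have key (X Y Z W) : T (φ X) (φ Y) (φ Z) (φ W) =
      T X Y Z W - T X Y (φ Z) (φ W) + T (φ X) (φ Y) Z W := by
    have e1 := h (φ X) (φ Y) (φ Z) (φ W)
    have e2 := h X Y (φ Z) (φ W)
    simp only [h1, h2, h3, h4] at e1 e2
    linarith
  have e1 := key X Y Z W
  have e2 := key Z W X Y
  rw [hpair (φ Z) (φ W) (φ X), hpair Z W X Y, hpair Z W (φ X), hpair (φ Z) (φ W) X] at e2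
  linarith

end GrayIdentities

section AlmostContact

variable {E : Type*} [NormedAddCommGroup E] [NormedSpace ℝ E]
  {H : Type*} [TopologicalSpace H] {I : ModelWithCorners ℝ E H}
  {M : Type*} [TopologicalSpace M] [ChartedSpace H M] [IsManifold I ∞ M]

variable (I M) in
/-- The additive group of smooth vector fields. -/
def smoothFields : AddSubgroup (Π x : M, TangentSpace I x) where
  carrier := {X | IsSmoothField I X}
  zero_mem' := contMDiff_zeroSection ℝ (TangentSpace I : M → Type _)
  add_mem' hX hY := ContMDiff.add_section hX hY
  neg_mem' hX := ContMDiff.neg_section hX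

variable [RiemannianBundle (fun x : M ↦ TangentSpace I x)]

namespace AlmostContactMetricStructure

variable (S : AlmostContactMetricStructure I M)

theorem phi_xi (p : M) : S.phi p (S.xi p) = 0 := by
  have h1 := S.phi_phi p (S.xi p)
  rw [S.eta_xi, one_smul, neg_add_cancel] at h1
  have h2 := S.phi_phi p (S.phi p (S.xi p))
  rw [h1, map_zero] at h2
  have h3 : S.phi p (S.xi p) = S.eta p (S.phi p (S.xi p)) • S.xi p := by
    linear_combination (norm := module) h2
  have h4 : (S.eta p (S.phi p (S.xi p)) * S.eta p (S.phi p (S.xi p))) • S.xi p = 0 := by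
    rw [← smul_smul, ← h3, ← map_smul, ← h3, h1]
  have h5 : S.eta p (S.phi p (S.xi p)) = 0 := by
    have := congrArg (S.eta p) h4
    simpa [S.eta_xi] using this
  rw [h3, h5, zero_smul]

theorem eta_phi (p : M) (v : TangentSpace I p) : S.eta p (S.phi p v) = 0 := by
  have h1 := S.phi_phi p (S.phi p v)
  rw [S.phi_phi p v, map_add, map_smul, S.phi_xi, smul_zero, add_zero, map_neg] at h1
  have h2 := congrArg (S.eta p) h1
  simpa [S.eta_xi] using h2

theorem inner_phi_left (p : M) (v w : TangentSpace I p) :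
    inner ℝ (S.phi p v) w = -inner ℝ v (S.phi p w) := by
  have h1 := S.inner_phi_phi p (S.phi p v) w
  have h2 := S.inner_phi_phi p (S.xi p) (S.phi p w)
  rw [S.phi_xi, inner_zero_left, S.eta_phi, mul_zero] at h2
  rw [S.phi_phi, S.eta_phi, inner_add_left, inner_smul_left, inner_neg_left] at h1
  simp only [conj_trivial] at h1
  linear_combination -h1 - S.eta p v * h2

theorem metricFun_phiField_phiField (X Y : Π x : M, TangentSpace I x) (p : M) :
    metricFun I (S.phiField X) (S.phiField Y) p
      = metricFun I X Y p - S.etaFun X p * S.etaFun Y p :=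
  S.inner_phi_phi p _ _

theorem metricFun_phiField_left (X Y : Π x : M, TangentSpace I x) (p : M) :
    metricFun I (S.phiField X) Y p = -metricFun I X (S.phiField Y) p :=
  S.inner_phi_left p _ _

/-- The vector field `η(X) ξ`. -/
noncomputable def verticalField (X : Π x : M, TangentSpace I x) : Π x : M, TangentSpace I x :=
  S.etaFun X • S.xi

variable {S} in
theorem isSmoothField_phiField {X : Π x : M, TangentSpace I x} (hX : IsSmoothField I X) :
    IsSmoothField I (S.phiField X) :=
  ContMDiff.clm_bundle_apply S.contMDiff_phi hX

theorem phiField_phiField_add (X : Π x : M, TangentSpace I x) :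
    S.phiField (S.phiField X) + X = S.verticalField X := by
  ext1 p
  simp [phiField, verticalField, etaFun, S.phi_phi]

theorem phiField_verticalField (X : Π x : M, TangentSpace I x) :
    S.phiField (S.verticalField X) = 0 := by
  ext1 p
  simp [phiField, verticalField, S.phi_xi]

theorem isSmoothField_verticalField {X : Π x : M, TangentSpace I x} (hX : IsSmoothField I X) :
    IsSmoothField I (S.verticalField X) := by
  rw [← S.phiField_phiField_add]
  exact (smoothFields I M).add_mem (isSmoothField_phiField (isSmoothField_phiField hX)) hX

/-- `φ` as a map of smooth vector fields. -/
noncomputable def phiSmooth (X : smoothFields I M) : smoothFields I M :=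
  ⟨S.phiField X, isSmoothField_phiField X.2⟩

/-- `η ⊗ ξ` as a map of smooth vector fields. -/
noncomputable def verticalSmooth (X : smoothFields I M) : smoothFields I M :=
  ⟨S.verticalField X, S.isSmoothField_verticalField X.2⟩

theorem phiSmooth_phiSmooth_add (X : smoothFields I M) :
    S.phiSmooth (S.phiSmooth X) + X = S.verticalSmooth X :=
  Subtype.ext (S.phiField_phiField_add X)

theorem phiSmooth_verticalSmooth (X : smoothFields I M) : S.phiSmooth (S.verticalSmooth X) = 0 :=
  Subtype.ext (S.phiField_verticalField X)

end AlmostContactMetricStructure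

variable [FiniteDimensional ℝ E]

/-- The curvature tensor minus the one of constant curvature `1`. -/
noncomputable def reducedRiemann (X Y Z W : Π x : M, TangentSpace I x) (p : M) : ℝ :=
  riemann I X Y Z W p
    - (metricFun I X Z p * metricFun I Y W p - metricFun I Y Z p * metricFun I X W p)

theorem reducedRiemann_add_right (p : M) (X Y Z W W' : smoothFields I M) :
    reducedRiemann (I := I) X Y Z (W + W' : smoothFields I M) p
      = reducedRiemann (I := I) X Y Z W p + reducedRiemann (I := I) X Y Z W' p := by
  simp only [reducedRiemann, riemann, metricFun, AddSubgroup.coe_add, Pi.add_apply, inner_add_right]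
  ring

namespace AlmostContactMetricStructure

variable (S : AlmostContactMetricStructure I M)

theorem satisfiesG1_iff : S.SatisfiesG1 ↔ ∀ (p : M) (X Y Z W : smoothFields I M),
    reducedRiemann (I := I) X Y (S.phiSmooth Z) (S.phiSmooth W) p
      = reducedRiemann (I := I) X Y Z W p := by
  refine ⟨fun h p X Y Z W ↦ ?_, fun h X Y Z W hX hY hZ hW p ↦ ?_⟩
  · have := h X Y Z W X.2 Y.2 Z.2 W.2 p
    simp only [reducedRiemann, phiSmooth]
    linarith
  · have := h p ⟨X, hX⟩ ⟨Y, hY⟩ ⟨Z, hZ⟩ ⟨W, hW⟩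
    simp only [reducedRiemann, phiSmooth] at this
    linarith

theorem satisfiesG2_iff : S.SatisfiesG2 ↔ ∀ (p : M) (X Y Z W : smoothFields I M),
    reducedRiemann (I := I) X Y Z W p
      = reducedRiemann (I := I) (S.phiSmooth X) Y Z (S.phiSmooth W) p
        + reducedRiemann (I := I) X (S.phiSmooth Y) Z (S.phiSmooth W) p
        + reducedRiemann (I := I) X Y (S.phiSmooth Z) (S.phiSmooth W) p := by
  refine ⟨fun h p X Y Z W ↦ ?_, fun h X Y Z W hX hY hZ hW p ↦ ?_⟩
  · have := h X Y Z W X.2 Y.2 Z.2 W.2 p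
    rw [metricFun_comm (Z : Π x : M, TangentSpace I x) Y] at this
    simp only [reducedRiemann, phiSmooth, S.metricFun_phiField_phiField,
      S.metricFun_phiField_left]
    linear_combination this
  · have := h p ⟨X, hX⟩ ⟨Y, hY⟩ ⟨Z, hZ⟩ ⟨W, hW⟩
    simp only [reducedRiemann, phiSmooth, S.metricFun_phiField_phiField,
      S.metricFun_phiField_left] at this
    rw [metricFun_comm Z Y]
    linear_combination this

theorem satisfiesG3_iff : S.SatisfiesG3 ↔ ∀ (p : M) (X Y Z W : smoothFields I M),
    reducedRiemann (I := I) X Y Z W p = reducedRiemann (I := I) (S.phiSmooth X) (S.phiSmooth Y)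
      (S.phiSmooth Z) (S.phiSmooth W) p := by
  refine ⟨fun h p X Y Z W ↦ ?_, fun h X Y Z W hX hY hZ hW p ↦ ?_⟩
  · have := h X Y Z W X.2 Y.2 Z.2 W.2 p
    rw [metricFun_comm (Z : Π x : M, TangentSpace I x) Y] at this
    simp only [reducedRiemann, phiSmooth, S.metricFun_phiField_phiField]
    linear_combination this
  · have := h p ⟨X, hX⟩ ⟨Y, hY⟩ ⟨Z, hZ⟩ ⟨W, hW⟩
    simp only [reducedRiemann, phiSmooth, S.metricFun_phiField_phiField] at this
    rw [metricFun_comm Z Y]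
    linear_combination this

end AlmostContactMetricStructure

variable [IsContMDiffRiemannianBundle I ∞ E (fun x : M ↦ TangentSpace I x)]

theorem reducedRiemann_swap_right (p : M) (X Y Z W : smoothFields I M) :
    reducedRiemann (I := I) X Y Z W p = -reducedRiemann (I := I) X Y W Z p := by
  simp only [reducedRiemann, riemann_swap_right X.2 Y.2 Z.2 W.2 p]
  ring

theorem reducedRiemann_swap_pairs (p : M) (X Y Z W : smoothFields I M) :
    reducedRiemann (I := I) X Y Z W p = reducedRiemann (I := I) Z W X Y p := by
  simp only [reducedRiemann, riemann_swap_pairs X.2 Y.2 Z.2 W.2 p]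
  simp only [metricFun_comm (Z : Π x : M, TangentSpace I x),
    metricFun_comm (W : Π x : M, TangentSpace I x)]
  ring

namespace AlmostContactMetricStructure

variable {S : AlmostContactMetricStructure I M}

theorem SatisfiesG1.satisfiesG2 (h : S.SatisfiesG1) : S.SatisfiesG2 := by
  rw [satisfiesG1_iff] at h
  rw [satisfiesG2_iff]
  intro p
  have h1 := reducedRiemann_swap_pairs (I := I) p
  have h3 := reducedRiemann_add_right (I := I) p
  have h' := h p
  generalize hT : (fun X Y Z W : smoothFields I M ↦ reducedRiemann (I := I) X Y Z W p) = T
  have hT' (X Y Z W : smoothFields I M) : reducedRiemann (I := I) X Y Z W p = T X Y Z W := by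
    rw [← hT]
  simp only [hT'] at h1 h3 h' ⊢
  exact gray_two_of_gray_one h1 h3 S.phiSmooth_phiSmooth_add S.phiSmooth_verticalSmooth h'

theorem SatisfiesG2.satisfiesG3 (h : S.SatisfiesG2) : S.SatisfiesG3 := by
  rw [satisfiesG2_iff] at h
  rw [satisfiesG3_iff]
  intro p
  have h1 := reducedRiemann_swap_pairs (I := I) p
  have h2 := reducedRiemann_swap_right (I := I) p
  have h3 := reducedRiemann_add_right (I := I) p
  have h' := h p
  generalize hT : (fun X Y Z W : smoothFields I M ↦ reducedRiemann (I := I) X Y Z W p) = T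
  have hT' (X Y Z W : smoothFields I M) : reducedRiemann (I := I) X Y Z W p = T X Y Z W := by
    rw [← hT]
  simp only [hT'] at h1 h2 h3 h' ⊢
  exact gray_three_of_gray_two h1 h2 h3 S.phiSmooth_phiSmooth_add S.phiSmooth_verticalSmooth h'

end AlmostContactMetricStructure

end AlmostContact

theorem mainTheorem4 (L : Set AlmostContactMetricManifold.{u}) :
    AlmostContactMetricManifold.subclassG1 L ⊆ AlmostContactMetricManifold.subclassG2 L ∧
      AlmostContactMetricManifold.subclassG2 L ⊆ AlmostContactMetricManifold.subclassG3 L ∧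
      AlmostContactMetricManifold.subclassG3 L ⊆ L := by
  exact ⟨fun _ h ↦ ⟨h.1, h.2.satisfiesG2⟩, fun _ h ↦ ⟨h.1, h.2.satisfiesG3⟩, fun _ h ↦ h.1⟩
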